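/- Theorem. Let $G$ be a finite simple undirected graph. Suppose that $G$ is outerplanar, i.e. $G$ has an embedding in the plane (vertices are distinct points, edges are simple curves joining their ends, no vertex lies on an edge of which it is not an end, and two distinct edges meet only in common ends) in which every vertex lies on the boundary of the outer (unbounded) face. Suppose further that $G$ has girth at least $6$, i.e. $G$ contains no cycle of length less than $6$ (in particular, acyclic graphs are allowed). Then $G$ is PCF $4$-colorable: there is a coloring $\varphi\colon V(G)\to\{1,2,3,4\}$ such that adjacent vertices receive different colors and, for every non-isolated vertex $v$, some color appears exactly once on the open neighborhood $N(v)$. -/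

import Mathlib

namespace SimpleGraph

/-- A planar embedding of `G`: distinct vertices are distinct points of the Euclidean plane, every
edge is a simple curve joining its two ends, no vertex lies on an edge of which it is not an end,
and two distinct edges meet at most in a common end. -/
structure PlanarEmbedding {V : Type*} (G : SimpleGraph V) where
  /-- the point that represents a vertex -/
  point : V → EuclideanSpace ℝ (Fin 2)
  /-- the set of points of the curve that represents an edge -/
  arc : G.edgeSet → Set (EuclideanSpace ℝ (Fin 2))
  point_injective : Function.Injective point
  exists_path : ∀ (u v : V) (h : G.Adj u v), ∃ γ : _root_.Path (point u) (point v),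
    Function.Injective γ ∧ Set.range γ = arc ⟨s(u, v), h⟩
  mem_of_point_mem_arc : ∀ (w : V) (e : G.edgeSet), point w ∈ arc e → w ∈ (e : Sym2 V)
  arc_inter_arc : ∀ e f : G.edgeSet, e ≠ f →
    arc e ∩ arc f ⊆ point '' {w | w ∈ (e : Sym2 V) ∧ w ∈ (f : Sym2 V)}

/-- The set of all points of the plane covered by the drawing (vertices and edges). -/
def PlanarEmbedding.support {V : Type*} {G : SimpleGraph V} (D : G.PlanarEmbedding) :
    Set (EuclideanSpace ℝ (Fin 2)) :=
  Set.range D.point ∪ ⋃ e : G.edgeSet, D.arc e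

/-- A face is a connected component of the complement of the drawing. -/
def PlanarEmbedding.IsFace {V : Type*} {G : SimpleGraph V} (D : G.PlanarEmbedding)
    (F : Set (EuclideanSpace ℝ (Fin 2))) : Prop :=
  ∃ x ∈ D.supportᶜ, F = connectedComponentIn D.supportᶜ x

/-- The outer face is the unbounded face (for a finite graph there is exactly one). -/
def PlanarEmbedding.IsOuterFace {V : Type*} {G : SimpleGraph V} (D : G.PlanarEmbedding)
    (F : Set (EuclideanSpace ℝ (Fin 2))) : Prop :=
  D.IsFace F ∧ ¬ Bornology.IsBounded F

/-- A graph is outerplanar if it has a planar embedding in which all vertices lie on the boundary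
of the outer face. -/
def IsOuterplanar {V : Type*} (G : SimpleGraph V) : Prop :=
  ∃ (D : G.PlanarEmbedding) (F : Set (EuclideanSpace ℝ (Fin 2))),
    D.IsOuterFace F ∧ ∀ v : V, D.point v ∈ frontier F

/-- A vertex coloring is conflict-free (with respect to open neighborhoods) if every non-isolated
vertex `v` has a color `a` that appears exactly once in the neighborhood of `v`. -/
def IsConflictFree {V α : Type*} (G : SimpleGraph V) (c : V → α) : Prop :=
  ∀ v : V, (G.neighborSet v).Nonempty → ∃ a : α, ∃! w : V, w ∈ G.neighborSet v ∧ c w = a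

/-- `G` is PCF `k`-colorable if it has a proper coloring with `k` available colors that is
conflict-free with respect to open neighborhoods. -/
def PCFColorable {V : Type*} (G : SimpleGraph V) (k : ℕ) : Prop :=
  ∃ c : G.Coloring (Fin k), G.IsConflictFree c

end SimpleGraph

/-!
The proof uses the embedding only through one consequence: an outerplanar graph contains no theta,
i.e. no subdivision of `K₂,₃` (`IsOuterplanar.noTheta`). A point of the outer face can be joined
inside this face to each vertex, up to the last piece of an edge at that vertex
(`PlanarEmbedding.joinedIn_face_union_star`), so a theta with vertices `a`, `b` and `p i` would
yield a drawing of `K₃,₃` in which edges without a common end are disjoint. No such drawing exists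
(`not_pairwise_disjoint_paths_completeBipartite`), even with continuous curves: for disjoint
edges `γ`, `δ` the difference `γ s - δ t` has a continuous logarithm on the square, hence its
increments along the sides of the square add up to zero, and these equations for all pairs of edges
without a common end contradict each other modulo `4`. This is the van Kampen obstruction, and it
avoids the Jordan curve theorem.

The remaining argument is combinatorial, by induction over subgraphs (`NoTheta.pcfColorable`). A
vertex of degree one can be removed and colored last. The same holds for four consecutive vertices
of degree two: two colors are forbidden for each outer and one for each inner vertex of the four,
and four colors leave enough room (`exists_thread_coloring`).

If there are edges but no vertex of degree one, then four such vertices exist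
(`NoTheta.exists_thread`). Call a set of non-isolated vertices a lobe if it is attached to the rest
of the graph at most at the two ends of an edge, and take a minimal lobe `S`, with ends `x` and `y`.
The degree condition gives a cycle in `S ∪ {x, y}`; a shortest one, `C`, has no chords. A component
outside `C` is attached to at most two vertices of `C`, which are consecutive, since it would form a
theta with `C` otherwise (`NoTheta.exists_attachment`). Such a component inside `S` would be a
smaller lobe, so only the component of `x` and `y` matters, and all but two consecutive vertices of
`C` have degree two. Since `C` has length at least six, at least four of them remain.
-/

/-! ### Logarithms along paths and the crossing parity of `K₃,₃` -/

section VanKampen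

open Set

/-- The increment over `[0, 1]` of a continuous logarithm of `f` (zero if `f` has none). -/
noncomputable def logIncrement (f : ℝ → ℂ) : ℂ :=
  open Classical in
  if h : ∃ l : ℝ → ℂ, Continuous l ∧ ∀ t, Complex.exp (l t) = f t then
    h.choose 1 - h.choose 0 else 0

theorem exists_continuous_log {A : Type*} [TopologicalSpace A] [SimplyConnectedSpace A]
    [LocallyPathConnectedSpace A] {f : A → ℂ} (hf : Continuous f) (h0 : ∀ x, f x ≠ 0) :
    ∃ l : A → ℂ, Continuous l ∧ ∀ x, Complex.exp (l x) = f x := by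
  obtain ⟨x₀⟩ : Nonempty A := inferInstance
  obtain ⟨l, ⟨-, hl⟩, -⟩ := Complex.isCoveringMapOn_exp.existsUnique_continuousMap_lifts
    ⟨f, hf⟩ (Complex.exp_log (h0 x₀)) (fun x ↦ h0 x)
  exact ⟨l, l.continuous, fun x ↦ congrFun hl x⟩

/-- Any continuous logarithm of a nonzero constant multiple of `f` computes `logIncrement f`. -/
theorem logIncrement_eq {f l : ℝ → ℂ} {c : ℂ} (hl : Continuous l) (hc : c ≠ 0)
    (h : ∀ t, Complex.exp (l t) = c * f t) : logIncrement f = l 1 - l 0 := by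
  have hex : ∃ l : ℝ → ℂ, Continuous l ∧ ∀ t, Complex.exp (l t) = f t := by
    refine ⟨fun t ↦ l t - Complex.log c, by fun_prop, fun t ↦ ?_⟩
    rw [Complex.exp_sub, h, Complex.exp_log hc, mul_div_cancel_left₀ _ hc]
  rw [logIncrement, dif_pos hex]
  obtain ⟨hm, hme⟩ := hex.choose_spec
  set m := hex.choose
  have hf : ∀ t, f t ≠ 0 := fun t ↦ hme t ▸ Complex.exp_ne_zero _
  have hd : ∀ t, Complex.exp (l t - m t) = c := fun t ↦ by
    rw [Complex.exp_sub, h, hme, mul_div_cancel_right₀ _ (hf t)]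
  have := Complex.isCoveringMap_exp.const_of_comp (g := fun t : ℝ ↦ l t - m t) (by fun_prop)
    (fun s t ↦ Subtype.ext ((hd s).trans (hd t).symm)) 1 0
  linear_combination -this

theorem exists_logIncrement_eq {f : ℝ → ℂ} (hf : Continuous f) (h0 : ∀ t, f t ≠ 0) {x y : ℂ}
    (hx : Complex.exp x = f 0) (hy : Complex.exp y = f 1) :
    ∃ n : ℤ, logIncrement f = y - x + n * (2 * Real.pi * Complex.I) := by
  obtain ⟨l, hl, hle⟩ := exists_continuous_log hf h0
  have h := logIncrement_eq (c := 1) hl one_ne_zero (by simpa using hle)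
  have : Complex.exp (l 1 - l 0 - (y - x)) = 1 := by
    rw [Complex.exp_sub, Complex.exp_sub, Complex.exp_sub, hle, hle, hx, hy, div_self]
    exact div_ne_zero (h0 _) (h0 _)
  obtain ⟨n, hn⟩ := Complex.exp_eq_one_iff.1 this
  exact ⟨n, by rw [h]; linear_combination hn⟩

/-- The difference of two disjoint paths has a logarithm on the square, so the increments along the
four sides of the square add up to zero. -/
theorem logIncrement_square {p q r s : ℂ} (γ : Path p q) (δ : Path r s)
    (h : Disjoint (range γ) (range δ)) :
    logIncrement (fun t ↦ γ.extend t - r) + logIncrement (fun t ↦ δ.extend t - q) =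
      logIncrement (fun t ↦ δ.extend t - p) + logIncrement (fun t ↦ γ.extend t - s) := by
  have hγ : ∀ t, γ.extend t ∈ range γ := fun t ↦ by
    rw [← γ.extend_range]; exact mem_range_self t
  have hδ : ∀ t, δ.extend t ∈ range δ := fun t ↦ by
    rw [← δ.extend_range]; exact mem_range_self t
  obtain ⟨L, hL, hLe⟩ := exists_continuous_log
    (f := fun x : ℝ × ℝ ↦ γ.extend x.1 - δ.extend x.2) (by fun_prop)
    (fun x ↦ sub_ne_zero.2 (h.ne_of_mem (hγ _) (hδ _)))
  rw [logIncrement_eq (f := fun t ↦ γ.extend t - r) (l := fun t ↦ L (t, 0)) (c := 1) (by fun_prop)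
      one_ne_zero (fun t ↦ by simp [hLe]),
    logIncrement_eq (f := fun t ↦ γ.extend t - s) (l := fun t ↦ L (t, 1)) (c := 1) (by fun_prop)
      one_ne_zero (fun t ↦ by simp [hLe]),
    logIncrement_eq (f := fun t ↦ δ.extend t - p) (l := fun t ↦ L (0, t)) (c := -1) (by fun_prop)
      (by norm_num) (fun t ↦ by simp [hLe]),
    logIncrement_eq (f := fun t ↦ δ.extend t - q) (l := fun t ↦ L (1, t)) (c := -1) (by fun_prop)
      (by norm_num) (fun t ↦ by simp [hLe])]
  ring

/-- A logarithm of `x i - x j`, chosen so that the values at `(j, i)` and `(i, j)` differ by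
exactly `π * I` for `i < j`. -/
noncomputable def orderedLog (x : Fin 3 → ℂ) (i j : Fin 3) : ℂ :=
  if i < j then Complex.log (x i - x j) else Complex.log (x j - x i) + Real.pi * Complex.I

theorem exp_orderedLog {x : Fin 3 → ℂ} {i j : Fin 3} (h : x i ≠ x j) :
    Complex.exp (orderedLog x i j) = x i - x j := by
  unfold orderedLog
  split_ifs
  · exact Complex.exp_log (sub_ne_zero.2 h)
  · rw [Complex.exp_add, Complex.exp_log (sub_ne_zero.2 h.symm), Complex.exp_pi_mul_I]
    ring

theorem orderedLog_sub_swap (x : Fin 3 → ℂ) {i j : Fin 3} (h : i ≠ j) :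
    orderedLog x j i - orderedLog x i j =
      ((if i < j then 1 else -1 : ℤ) : ℂ) * (Real.pi * Complex.I) := by
  unfold orderedLog
  rcases lt_or_gt_of_ne h with h | h <;> simp [h, h.not_gt]

/-- The graph `K₃,₃` cannot be drawn in the plane, even if only edges without a common end are
required to be disjoint. The equations of `logIncrement_square` for the pairs of such edges are
inconsistent modulo `4`: every increment occurs in two of them, while the signs of
`orderedLog_sub_swap` add up to `2`. -/
theorem not_pairwise_disjoint_paths_completeBipartite (a b : Fin 3 → ℂ)
    (γ : ∀ i j, Path (a i) (b j))
    (h : ∀ i i' j j', i ≠ i' → j ≠ j' → Disjoint (range (γ i j)) (range (γ i' j'))) : False := by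
  have ha : ∀ {i i'}, i ≠ i' → ∀ j t, (γ i j).extend t ≠ a i' := fun {i i'} hi j t ↦ by
    obtain ⟨j', hj'⟩ := exists_ne j
    refine (h i i' j j' hi hj'.symm).ne_of_mem ?_ ⟨0, by simp⟩
    rw [← (γ i j).extend_range]; exact mem_range_self t
  have hb : ∀ {j j'}, j ≠ j' → ∀ i t, (γ i j).extend t ≠ b j' := fun {j j'} hj i t ↦ by
    obtain ⟨i', hi'⟩ := exists_ne i
    refine (h i i' j j' hi'.symm hj).ne_of_mem ?_ ⟨1, by simp⟩
    rw [← (γ i j).extend_range]; exact mem_range_self t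
  have hab : ∀ i j, a i - b j ≠ 0 := fun i j ↦ by
    obtain ⟨j', hj'⟩ := exists_ne j
    simpa [sub_eq_zero] using hb hj' i 0
  have haa : ∀ {i i'}, i ≠ i' → a i ≠ a i' := fun {i i'} hi ↦ by simpa using ha hi 0 0
  have hbb : ∀ {i i'}, i ≠ i' → b i ≠ b i' := fun {i i'} hi ↦ by simpa using hb hi 0 1
  -- the increments around a vertex, up to integers, in terms of fixed logarithms of the differences
  -- of the vertices; `log (a i - b j)` is used for `a i - b j`, and `log (a i - b j) + π * I` for
  -- `b j - a i`, so that these logarithms cancel in each equation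
  have hA : ∀ k i j, ∃ n : ℤ, i ≠ k → logIncrement (fun t ↦ (γ i j).extend t - a k) =
      Complex.log (a k - b j) + Real.pi * Complex.I - orderedLog a i k
        + n * (2 * Real.pi * Complex.I) := fun k i j ↦ by
    by_cases hik : i = k
    · exact ⟨0, fun h ↦ absurd hik h⟩
    · obtain ⟨n, hn⟩ := exists_logIncrement_eq (f := fun t ↦ (γ i j).extend t - a k)
        (x := orderedLog a i k) (y := Complex.log (a k - b j) + Real.pi * Complex.I)
        (by fun_prop) (fun t ↦ sub_ne_zero.2 (ha hik j t))
        (by simp [exp_orderedLog (haa hik)])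
        (by rw [Complex.exp_add, Complex.exp_log (hab _ _), Complex.exp_pi_mul_I]; simp)
      exact ⟨n, fun _ ↦ hn⟩
  have hB : ∀ k i j, ∃ n : ℤ, j ≠ k → logIncrement (fun t ↦ (γ i j).extend t - b k) =
      orderedLog b j k - Complex.log (a i - b k) + n * (2 * Real.pi * Complex.I) := fun k i j ↦ by
    by_cases hjk : j = k
    · exact ⟨0, fun h ↦ absurd hjk h⟩
    · obtain ⟨n, hn⟩ := exists_logIncrement_eq (f := fun t ↦ (γ i j).extend t - b k)
        (x := Complex.log (a i - b k)) (y := orderedLog b j k)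
        (by fun_prop) (fun t ↦ sub_ne_zero.2 (hb hjk i t))
        (by simp [Complex.exp_log (hab _ _)])
        (by simp [exp_orderedLog (hbb hjk)])
      exact ⟨n, fun _ ↦ hn⟩
  choose m hm using hA
  choose n hn using hB
  have key : ∀ i i' j j', i ≠ i' → j ≠ j' →
      (if i < i' then 1 else -1 : ℤ) + (if j < j' then 1 else -1 : ℤ) =
        2 * (m i i' j' + n j' i j - m i' i j - n j i' j') := by
    intro i i' j j' hi hj
    have e := logIncrement_square (γ i j) (γ i' j') (h i i' j j' hi hj)
    rw [hm _ _ _ hi, hm _ _ _ hi.symm, hn _ _ _ hj, hn _ _ _ hj.symm] at e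
    have e1 := orderedLog_sub_swap a hi
    have e2 := orderedLog_sub_swap b hj
    have hpi : (Real.pi * Complex.I : ℂ) ≠ 0 :=
      mul_ne_zero (Complex.ofReal_ne_zero.2 Real.pi_ne_zero) Complex.I_ne_zero
    rw [← Int.cast_inj (α := ℂ), ← mul_left_inj' hpi]
    push_cast at e1 e2 ⊢
    linear_combination -e1 - e2 + e
  have k1 := key 0 1 0 1 (by decide) (by decide)
  have k2 := key 0 1 0 2 (by decide) (by decide)
  have k3 := key 0 1 1 2 (by decide) (by decide)
  have k4 := key 0 2 0 1 (by decide) (by decide)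
  have k5 := key 0 2 0 2 (by decide) (by decide)
  have k6 := key 0 2 1 2 (by decide) (by decide)
  have k7 := key 1 2 0 1 (by decide) (by decide)
  have k8 := key 1 2 0 2 (by decide) (by decide)
  have k9 := key 1 2 1 2 (by decide) (by decide)
  have l1 := key 0 1 1 0 (by decide) (by decide)
  have l2 := key 0 1 2 0 (by decide) (by decide)
  have l3 := key 0 1 2 1 (by decide) (by decide)
  have l4 := key 0 2 1 0 (by decide) (by decide)
  have l5 := key 0 2 2 0 (by decide) (by decide)
  have l6 := key 0 2 2 1 (by decide) (by decide)
  have l7 := key 1 2 1 0 (by decide) (by decide)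
  have l8 := key 1 2 2 0 (by decide) (by decide)
  have l9 := key 1 2 2 1 (by decide) (by decide)
  simp only [Fin.reduceLT, if_true] at k1 k2 k3 k4 k5 k6 k7 k8 k9
  simp only [Fin.reduceLT, if_true, if_false] at l1 l2 l3 l4 l5 l6 l7 l8 l9
  omega

end VanKampen

/-! ### Drawings with all vertices on the outer face contain no subdivision of `K₂,₃` -/

namespace SimpleGraph

open Set

variable {V : Type*} {G : SimpleGraph V}

/-- `G` contains no theta, that is, no subdivision of `K₂,₃`. The configuration is encoded in a weak
form, which makes its absence easier to apply: vertices `a`, `b` and three vertices `p i`, all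
joined to `a` and to `b` by walks, such that a walk from `a` and a walk from `b` are disjoint if they lead
to different `p i`. Walks from the same side, and the two walks to the same `p i`, may share further
vertices. -/
def NoTheta (G : SimpleGraph V) : Prop :=
  ∀ (a b : V) (p : Fin 3 → V) (A : ∀ i, G.Walk a (p i)) (B : ∀ i, G.Walk b (p i)),
    ¬ ∀ i j, i ≠ j → (A i).support.Disjoint (B j).support

theorem NoTheta.mono {H : SimpleGraph V} (hG : G.NoTheta) (hle : H ≤ G) : H.NoTheta :=
  fun a b p A B h ↦ hG a b p (fun i ↦ (A i).mapLe hle) (fun i ↦ (B i).mapLe hle)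
    (by simpa using h)

namespace PlanarEmbedding

variable (D : G.PlanarEmbedding)

/-- The part of the drawing that represents the subgraph induced by `U`. -/
def carrier (U : Set V) : Set (EuclideanSpace ℝ (Fin 2)) :=
  D.point '' U ∪ ⋃ (e : G.edgeSet) (_ : ∀ v ∈ (e : Sym2 V), v ∈ U), D.arc e

variable {D}

theorem point_mem_arc {e : G.edgeSet} {w : V} (hw : w ∈ (e : Sym2 V)) : D.point w ∈ D.arc e := by
  obtain ⟨e, he⟩ := e
  induction e with
  | h u v =>
    obtain ⟨γ, -, hγ⟩ := D.exists_path u v he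
    rw [← hγ]
    rcases Sym2.mem_iff.1 hw with rfl | rfl
    · exact ⟨0, γ.source⟩
    · exact ⟨1, γ.target⟩

theorem isCompact_arc (e : G.edgeSet) : IsCompact (D.arc e) := by
  obtain ⟨e, he⟩ := e
  induction e with
  | h u v =>
    obtain ⟨γ, -, hγ⟩ := D.exists_path u v he
    rw [← hγ]
    exact isCompact_range γ.continuous

theorem isClosed_support [Finite V] : IsClosed D.support :=
  (finite_range _).isClosed.union (isClosed_iUnion_of_finite fun e ↦ (isCompact_arc e).isClosed)

theorem carrier_subset_support (U : Set V) : D.carrier U ⊆ D.support :=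
  union_subset_union (image_subset_range _ _) (iUnion_mono fun _ ↦ iUnion_subset fun _ ↦ le_rfl)

theorem carrier_mono {U U' : Set V} (h : U ⊆ U') : D.carrier U ⊆ D.carrier U' :=
  union_subset_union (image_mono h) (iUnion_mono fun _ ↦ iUnion_mono' fun hv ↦
    ⟨fun v hve ↦ h (hv v hve), le_rfl⟩)

theorem disjoint_carrier {U U' : Set V} (h : Disjoint U U') :
    Disjoint (D.carrier U) (D.carrier U') := by
  rw [Set.disjoint_left] at h ⊢
  rintro x (⟨u, hu, rfl⟩ | hx) hx'
  · rcases hx' with ⟨u', hu', hx'⟩ | hx'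
    · exact h hu (D.point_injective hx' ▸ hu')
    · obtain ⟨e, he, hx'⟩ := mem_iUnion₂.1 hx'
      exact h hu (he _ (D.mem_of_point_mem_arc _ _ hx'))
  · obtain ⟨e, he, hx⟩ := mem_iUnion₂.1 hx
    rcases hx' with ⟨u', hu', rfl⟩ | hx'
    · exact h (he _ (D.mem_of_point_mem_arc _ _ hx)) hu'
    · obtain ⟨f, hf, hx'⟩ := mem_iUnion₂.1 hx'
      have hef : e ≠ f := by
        rintro rfl
        obtain ⟨e, he'⟩ := e
        induction e with
        | h u v => exact h (he u (Sym2.mem_mk_left _ _)) (hf u (Sym2.mem_mk_left _ _))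
      obtain ⟨w, ⟨hwe, hwf⟩, -⟩ := D.arc_inter_arc e f hef ⟨hx, hx'⟩
      exact h (he w hwe) (hf w hwf)

theorem exists_path_of_walk {u v : V} (w : G.Walk u v) :
    ∃ γ : _root_.Path (D.point u) (D.point v), range γ ⊆ D.carrier {x | x ∈ w.support} := by
  induction w with
  | nil =>
    refine ⟨.refl _, ?_⟩
    rintro _ ⟨t, rfl⟩
    exact Or.inl ⟨_, by simp, rfl⟩
  | @cons u v w h p ih =>
    obtain ⟨γ, hγ⟩ := ih
    obtain ⟨δ, -, hδ⟩ := D.exists_path _ _ h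
    refine ⟨δ.trans γ, ?_⟩
    rw [Path.trans_range]
    refine union_subset ?_ (hγ.trans (carrier_mono fun x hx ↦ by simp_all))
    rw [hδ]
    refine fun y hy ↦ Or.inr (mem_iUnion₂.2 ⟨⟨s(u, v), h⟩, fun x hx ↦ ?_, hy⟩)
    rcases Sym2.mem_iff.1 hx with rfl | rfl <;> simp

variable (D) in
/-- The point of `w` together with the arcs of the edges at `w`, without their other ends. -/
def star (w : V) : Set (EuclideanSpace ℝ (Fin 2)) :=
  {y | (y = D.point w ∨ ∃ e : G.edgeSet, w ∈ (e : Sym2 V) ∧ y ∈ D.arc e) ∧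
    ∀ v, v ≠ w → y ≠ D.point v}

theorem disjoint_star_carrier {w : V} {U : Set V} (hw : w ∉ U) :
    Disjoint (D.star w) (D.carrier U) := by
  rw [Set.disjoint_left]
  rintro y ⟨hy, hyv⟩ (⟨u, hu, rfl⟩ | hx)
  · exact hyv u (by rintro rfl; exact hw hu) rfl
  · obtain ⟨f, hf, hx⟩ := mem_iUnion₂.1 hx
    rcases hy with rfl | ⟨e, he, hy⟩
    · exact hw (hf _ (D.mem_of_point_mem_arc _ _ hx))
    · have hef : e ≠ f := by
        rintro rfl
        exact hw (hf _ he)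
      obtain ⟨x, ⟨hwe, hwf⟩, hxy⟩ := D.arc_inter_arc e f hef ⟨hy, hx⟩
      exact hyv x (by rintro rfl; exact hw (hf _ hwf)) hxy.symm

/-- Walking along an arc to its end `w`, one does not meet the other end. -/
theorem joinedIn_star {w : V} {y : EuclideanSpace ℝ (Fin 2)} (hy : y ∈ D.star w) :
    JoinedIn (D.star w) y (D.point w) := by
  obtain ⟨hy, hyv⟩ := hy
  rcases hy with rfl | ⟨⟨e, he⟩, hwe, hy⟩
  · exact JoinedIn.refl ⟨Or.inl rfl, hyv⟩
  · obtain ⟨v, rfl⟩ := Sym2.mem_iff_exists.1 hwe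
    obtain ⟨γ, hγi, hγ⟩ := D.exists_path w v he
    rw [← hγ] at hy
    obtain ⟨τ, rfl⟩ := hy
    have hτ : τ ≠ 1 := by
      rintro rfl
      exact hyv v (G.ne_of_adj he).symm γ.target
    refine JoinedIn.symm ⟨⟨⟨fun t ↦ γ (t * τ), by fun_prop⟩, by simp, by simp⟩, fun t ↦ ?_⟩
    refine ⟨Or.inr ⟨⟨s(w, v), he⟩, hwe, hγ ▸ mem_range_self _⟩, fun x hx hxe ↦ ?_⟩
    have hxe' : γ (t * τ) = D.point x := hxe
    have hxm := D.mem_of_point_mem_arc x ⟨s(w, v), he⟩ (by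
      rw [← hxe', ← hγ]; exact mem_range_self _)
    rcases Sym2.mem_iff.1 hxm with rfl | rfl
    · exact hx rfl
    · have h1 := congrArg Subtype.val (hγi (hxe'.trans γ.target.symm))
      have h2 : (τ : ℝ) < 1 := lt_of_le_of_ne τ.2.2 (fun h ↦ hτ (Subtype.ext h))
      have h3 : (t * τ : ℝ) = 1 := h1
      nlinarith [t.2.1, t.2.2, τ.2.1]

/-- A vertex on the boundary of a face can be reached from inside the face without meeting any
part of the drawing but the edges at this vertex: go straight towards the vertex from a nearby point
of the face up to the first point of the drawing, and on along the arc that was hit. -/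
theorem joinedIn_face_union_star [Finite V] {F : Set (EuclideanSpace ℝ (Fin 2))} (hF : D.IsFace F)
    {w : V} (hw : D.point w ∈ closure F) {z : EuclideanSpace ℝ (Fin 2)} (hz : z ∈ F) :
    JoinedIn (F ∪ D.star w) z (D.point w) := by
  obtain ⟨x, hx, rfl⟩ := hF
  have hopen : IsOpen (connectedComponentIn D.supportᶜ x) :=
    isClosed_support.isOpen_compl.connectedComponentIn
  have hpc := hopen.isConnected_iff_isPathConnected.1
    (isConnected_connectedComponentIn_iff.2 hx)
  set F := connectedComponentIn D.supportᶜ x with hFdef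
  -- everything drawn away from `w` has positive distance from the point of `w`
  let K : Set (EuclideanSpace ℝ (Fin 2)) :=
    D.point '' {v | v ≠ w} ∪ ⋃ e : {e : G.edgeSet // w ∉ (e : Sym2 V)}, D.arc e
  have hK : IsClosed K := (toFinite _).isClosed.union
    (isClosed_iUnion_of_finite fun e ↦ (isCompact_arc _).isClosed)
  have hwK : D.point w ∈ Kᶜ := by
    rintro (⟨v, hv, hvw⟩ | hmem)
    · exact hv (D.point_injective hvw)
    · obtain ⟨e, he⟩ := mem_iUnion.1 hmem
      exact e.2 (D.mem_of_point_mem_arc _ _ he)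
  obtain ⟨r, hr, hball⟩ := Metric.isOpen_iff.1 hK.isOpen_compl _ hwK
  obtain ⟨y, hyF, hyw⟩ := Metric.mem_closure_iff.1 hw r hr
  have hyball : y ∈ Metric.ball (D.point w) r := by rwa [Metric.mem_ball, _root_.dist_comm]
  have hstar : D.support ∩ Metric.ball (D.point w) r ⊆ D.star w := by
    rintro q ⟨hqs, hqb⟩
    have hqK := hball hqb
    refine ⟨?_, fun v hv hqv ↦ hqK (Or.inl ⟨v, hv, hqv.symm⟩)⟩
    rcases hqs with ⟨v, rfl⟩ | hq
    · by_cases hv : v = w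
      · exact Or.inl (hv ▸ rfl)
      · exact absurd (Or.inl ⟨v, hv, rfl⟩) hqK
    · obtain ⟨e, he⟩ := mem_iUnion.1 hq
      by_cases hwe : w ∈ (e : Sym2 V)
      · exact Or.inr ⟨e, hwe, he⟩
      · exact absurd (Or.inr (mem_iUnion.2 ⟨⟨e, hwe⟩, he⟩)) hqK
  let σ : ℝ → EuclideanSpace ℝ (Fin 2) := fun t ↦ AffineMap.lineMap y (D.point w) t
  have hσ : Continuous σ := AffineMap.lineMap_continuous
  have hσball : ∀ t ∈ Icc (0 : ℝ) 1, σ t ∈ Metric.ball (D.point w) r := fun t ht ↦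
    (convex_ball _ _).segment_subset hyball (Metric.mem_ball_self hr)
      (by rw [segment_eq_image_lineMap]; exact ⟨t, ht, rfl⟩)
  -- the first point of the drawing on the segment
  have hTc : IsCompact (Icc (0 : ℝ) 1 ∩ σ ⁻¹' D.support) :=
    isCompact_Icc.inter_right (isClosed_support.preimage hσ)
  obtain ⟨τ, ⟨⟨hτ0, hτ1⟩, hτs⟩, hτmin⟩ := hTc.exists_isLeast
    ⟨1, ⟨zero_le_one, le_rfl⟩, Or.inl ⟨w, by simp [σ]⟩⟩
  have hbefore : σ '' Ico 0 τ ⊆ F := by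
    rcases eq_or_lt_of_le hτ0 with rfl | hτ0
    · simp
    have hyx : F = connectedComponentIn D.supportᶜ y := connectedComponentIn_eq hyF
    rw [hyx]
    refine (isPreconnected_Ico.image σ hσ.continuousOn).subset_connectedComponentIn
      ⟨0, ⟨le_rfl, hτ0⟩, by simp [σ]⟩ ?_
    rintro _ ⟨t, ht, rfl⟩ hts
    exact absurd (hτmin ⟨⟨ht.1, ht.2.le.trans hτ1⟩, hts⟩) (not_le.2 ht.2)
  have hstarτ : σ τ ∈ D.star w := hstar ⟨hτs, hσball τ ⟨hτ0, hτ1⟩⟩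
  have h1 : JoinedIn (F ∪ D.star w) z y := (hpc.joinedIn z hz y hyF).mono subset_union_left
  have h2 : JoinedIn (F ∪ D.star w) y (σ τ) := by
    refine JoinedIn.ofLine (f := fun t ↦ σ (t * τ)) (by fun_prop) (by simp [σ]) (by simp) ?_
    rintro _ ⟨t, ⟨ht0, ht1⟩, rfl⟩
    rcases eq_or_lt_of_le (mul_le_of_le_one_left hτ0 ht1) with h | h
    · exact Or.inr (by simpa only [h] using hstarτ)
    · exact Or.inl (hbefore ⟨_, ⟨mul_nonneg ht0 hτ0, h⟩, rfl⟩)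
  exact h1.trans (h2.trans ((joinedIn_star hstarτ).mono subset_union_right))

end PlanarEmbedding

open PlanarEmbedding in
/-- A point of the outer face, joined to the three vertices `p i`, would complete a theta to a
drawing of `K₃,₃`. -/
theorem IsOuterplanar.noTheta [Finite V] (hG : G.IsOuterplanar) : G.NoTheta := by
  intro a b p A B h
  obtain ⟨D, F, ⟨hF, -⟩, hv⟩ := hG
  obtain ⟨z, hz, hFz⟩ := id hF
  have hzF : z ∈ F := hFz ▸ mem_connectedComponentIn hz
  have hFs : Disjoint F D.support :=
    Set.disjoint_left.2 fun y hy ↦ by rw [hFz] at hy; exact connectedComponentIn_subset _ _ hy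
  let S : Fin 3 → Fin 3 → Set (EuclideanSpace ℝ (Fin 2)) := ![
    fun j ↦ D.carrier {x | x ∈ (A j).support}, fun j ↦ D.carrier {x | x ∈ (B j).support},
    fun j ↦ F ∪ D.star (p j)]
  have hγ : ∀ i j, ∃ γ : _root_.Path (![D.point a, D.point b, z] i) (D.point (p j)),
      range γ ⊆ S i j := by
    intro i j
    fin_cases i
    · exact exists_path_of_walk (A j)
    · exact exists_path_of_walk (B j)
    · obtain ⟨γ, hγ⟩ := joinedIn_face_union_star hF (frontier_subset_closure (hv (p j))) hzF
      exact ⟨γ, range_subset_iff.2 hγ⟩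
  choose γ hγ using hγ
  have hAB : ∀ j j', j ≠ j' → Disjoint (S 0 j) (S 1 j') := fun j j' hj ↦
    disjoint_carrier (Set.disjoint_left.2 fun _ hx hx' ↦ h j j' hj hx hx')
  have hout : ∀ w U, w ∉ U → Disjoint (F ∪ D.star w) (D.carrier U) := fun w U hw ↦
    (hFs.mono_right (carrier_subset_support U)).union_left (disjoint_star_carrier hw)
  have hA : ∀ j j', j ≠ j' → Disjoint (S 2 j) (S 0 j') := fun j j' hj ↦
    hout _ _ fun hx ↦ h j' j hj.symm hx (B j).end_mem_support
  have hB : ∀ j j', j ≠ j' → Disjoint (S 2 j) (S 1 j') := fun j j' hj ↦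
    hout _ _ fun hx ↦ h j j' hj (A j).end_mem_support hx
  have hS : ∀ i i' j j', i ≠ i' → j ≠ j' → Disjoint (S i j) (S i' j') := by
    intro i i' j j' hi hj
    fin_cases i <;> fin_cases i'
    · exact absurd rfl hi
    · exact hAB j j' hj
    · exact (hA j' j hj.symm).symm
    · exact (hAB j' j hj.symm).symm
    · exact absurd rfl hi
    · exact (hB j' j hj.symm).symm
    · exact hA j j' hj
    · exact hB j j' hj
    · exact absurd rfl hi
  let Φ : EuclideanSpace ℝ (Fin 2) ≃ₗᵢ[ℝ] ℂ := Complex.orthonormalBasisOneI.repr.symm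
  refine not_pairwise_disjoint_paths_completeBipartite _ _
    (fun i j ↦ (γ i j).map Φ.continuous) fun i i' j j' hi hj ↦ ?_
  have hr : ∀ i j, range ((γ i j).map Φ.continuous) ⊆ Φ '' S i j := fun i j ↦ by
    rintro _ ⟨t, rfl⟩
    exact ⟨_, hγ i j (mem_range_self t), rfl⟩
  exact ((Set.disjoint_image_iff Φ.injective).2 (hS i i' j j' hi hj)).mono (hr i j) (hr i' j')

/-! ### Cycles as periodic sequences -/

/-- The sequence `c` runs periodically around a cycle of length `n` of `G`. -/
structure IsCycleSeq (G : SimpleGraph V) (n : ℕ) (c : ℕ → V) : Prop where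
  three_le : 3 ≤ n
  adj : ∀ i, G.Adj (c i) (c (i + 1))
  eq_iff : ∀ i j, c i = c j ↔ i ≡ j [MOD n]

theorem isCycleSeq_of_segment {n : ℕ} {p : ℕ → V} (hn : 3 ≤ n)
    (hadj : ∀ i, i + 1 < n → G.Adj (p i) (p (i + 1))) (hclose : G.Adj (p (n - 1)) (p 0))
    (hinj : ∀ i < n, ∀ j < n, p i = p j → i = j) : G.IsCycleSeq n fun i ↦ p (i % n) where
  three_le := hn
  adj i := by
    have hi : i % n < n := Nat.mod_lt _ (by omega)
    rcases Nat.lt_or_ge (i % n + 1) n with h | h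
    · rw [Nat.add_mod, Nat.mod_eq_of_lt (show 1 < n by omega), Nat.mod_eq_of_lt h]
      exact hadj _ h
    · have h' : i % n = n - 1 := by omega
      rw [Nat.add_mod, Nat.mod_eq_of_lt (show 1 < n by omega), h', Nat.sub_add_cancel (by omega),
        Nat.mod_self]
      exact hclose
  eq_iff i j := ⟨hinj _ (Nat.mod_lt _ (by omega)) _ (Nat.mod_lt _ (by omega)), congrArg p⟩

theorem exists_walk_of_segment {c : ℕ → V} (k i : ℕ)
    (hadj : ∀ l, i ≤ l → l < i + k → G.Adj (c l) (c (l + 1))) :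
    ∃ w : G.Walk (c i) (c (i + k)), w.support = (List.range' i (k + 1)).map c ∧
      ∀ e ∈ w.edges, ∃ l, i ≤ l ∧ l < i + k ∧ e = s(c l, c (l + 1)) := by
  induction k generalizing i with
  | zero => exact ⟨.nil, by simp, by simp⟩
  | succ k ih =>
    obtain ⟨w, hw, he⟩ := ih (i + 1) fun l hl hl' ↦ hadj l (by omega) (by omega)
    refine ⟨.cons (hadj i le_rfl (by omega)) (w.copy rfl (by congr 1; omega)), ?_, ?_⟩
    · rw [List.range'_succ]
      simp [hw]
    · simp only [Walk.edges_cons, Walk.edges_copy, List.mem_cons, forall_eq_or_imp]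
      refine ⟨⟨i, le_rfl, by omega, rfl⟩, fun e hmem ↦ ?_⟩
      obtain ⟨l, h1, h2, h3⟩ := he e hmem
      exact ⟨l, by omega, by omega, h3⟩

namespace IsCycleSeq

variable {n : ℕ} {c : ℕ → V}

theorem shift (h : G.IsCycleSeq n c) (k : ℕ) : G.IsCycleSeq n fun i ↦ c (k + i) where
  three_le := h.three_le
  adj i := h.adj (k + i)
  eq_iff i j := by rw [h.eq_iff]; exact Nat.ModEq.add_iff_left rfl

theorem eq_of_lt (h : G.IsCycleSeq n c) {i j : ℕ} (hi : i < n) (hj : j < n) (hij : c i = c j) :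
    i = j :=
  ((h.eq_iff i j).1 hij).eq_of_lt_of_lt hi hj

theorem apply_add (h : G.IsCycleSeq n c) (i : ℕ) : c (i + n) = c i :=
  (h.eq_iff _ _).2 (by simp)

theorem adj_zero (h : G.IsCycleSeq n c) : G.Adj (c 0) (c (n - 1)) := by
  have h3 := h.three_le
  have h1 := h.adj (n - 1)
  have h2 := h.apply_add 0
  rw [Nat.zero_add] at h2
  rw [Nat.sub_add_cancel (by omega), h2] at h1
  exact h1.symm

theorem exists_lt_eq (h : G.IsCycleSeq n c) (k i : ℕ) : ∃ m < n, c i = c (k + m) := by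
  have h3 := h.three_le
  refine ⟨(i + (n - k % n)) % n, Nat.mod_lt _ (by omega), (h.eq_iff _ _).2 ?_⟩
  have hk : k % n < n := Nat.mod_lt _ (by omega)
  have h1 : k + (i + (n - k % n)) = i + n * (k / n) + n := by
    have := Nat.mod_add_div k n
    omega
  calc i ≡ i + n * (k / n) + n [MOD n] := by simp [Nat.ModEq]
    _ = k + (i + (n - k % n)) := h1.symm
    _ ≡ k + (i + (n - k % n)) % n [MOD n] := (Nat.mod_modEq _ _).symm.add_left k

theorem egirth_le (h : G.IsCycleSeq n c) : G.egirth ≤ n := by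
  have h3 := h.three_le
  obtain ⟨w, hw, he⟩ := exists_walk_of_segment (G := G) (c := c) (n - 1) 0 fun l _ _ ↦ h.adj l
  have hclose : G.Adj (c (0 + (n - 1))) (c 0) := by simpa using h.adj_zero.symm
  have hp : w.IsPath := by
    refine Walk.IsPath.mk' ?_
    rw [hw, List.nodup_map_iff_inj_on List.nodup_range']
    intro i hi j hj hij
    rw [List.mem_range'_1] at hi hj
    exact h.eq_of_lt (by omega) (by omega) hij
  have hcyc : (Walk.cons hclose w).IsCycle := by
    rw [Walk.cons_isCycle_iff]
    refine ⟨hp, fun hmem ↦ ?_⟩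
    obtain ⟨l, -, hl, hle⟩ := he _ hmem
    rcases Sym2.eq_iff.1 hle with ⟨h1, h2⟩ | ⟨h1, h2⟩
    · have := h.eq_of_lt (by omega) (by omega) h1
      omega
    · have := h.eq_of_lt (by omega) (by omega) h1
      have := h.eq_of_lt (by omega) (by omega) h2
      omega
  have hlen : (Walk.cons hclose w).length = n := by
    have := congrArg List.length hw
    simp only [Walk.length_support, List.length_map, List.length_range'] at this
    rw [Walk.length_cons]
    omega
  exact hlen ▸ egirth_le_length hcyc

/-- A shortest cycle in `W` has no chords. -/
theorem eq_of_adj_zero {W : Set V} (h : G.IsCycleSeq n c) (hW : ∀ i, c i ∈ W)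
    (hmin : ∀ m c', G.IsCycleSeq m c' → (∀ i, c' i ∈ W) → n ≤ m) {l : ℕ} (hl : l < n)
    (hadj : G.Adj (c 0) (c l)) : l = 1 ∨ l = n - 1 := by
  by_contra! hne
  have hl0 : l ≠ 0 := by
    rintro rfl
    exact G.irrefl hadj
  have := hmin (l + 1) _ (isCycleSeq_of_segment (p := c) (by omega) (fun i _ ↦ h.adj i)
    (by simpa using hadj.symm) fun i hi j hj ↦ h.eq_of_lt (by omega) (by omega)) fun i ↦ hW _
  omega

end IsCycleSeq

/-! ### Attachments of the components outside a cycle -/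

/-- The vertex `v` can be reached from `u` without entering `C`. -/
def ReachableOff (G : SimpleGraph V) (C : Set V) : V → V → Prop :=
  Relation.ReflTransGen fun a b ↦ G.Adj a b ∧ b ∉ C

namespace ReachableOff

variable {C : Set V} {u v : V}

theorem notMem (h : G.ReachableOff C u v) (hu : u ∉ C) : v ∉ C := by
  induction h with
  | refl => exact hu
  | tail _ h _ => exact h.2

theorem symm (h : G.ReachableOff C u v) (hu : u ∉ C) : G.ReachableOff C v u := by
  induction h with
  | refl => exact .refl
  | @tail b d hb h ih => exact .head ⟨h.1.symm, notMem hb hu⟩ ih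

theorem exists_walk (h : G.ReachableOff C u v) :
    ∃ w : G.Walk u v, ∀ x ∈ w.support, G.ReachableOff C u x := by
  induction h with
  | refl => exact ⟨.nil, by simpa using .refl⟩
  | @tail b d hb h ih =>
    obtain ⟨w, hw⟩ := ih
    refine ⟨w.concat h.1, fun x hx ↦ ?_⟩
    rw [Walk.support_concat, List.mem_append, List.mem_singleton] at hx
    rcases hx with hx | rfl
    · exact hw x hx
    · exact hb.tail h

end ReachableOff

/-- A component outside a cycle that is attached to two vertices of the cycle which are not
consecutive would form a theta with the two sides of the cycle. -/
theorem NoTheta.eq_of_attached (hG : G.NoTheta) {n : ℕ} {c : ℕ → V} (hc : G.IsCycleSeq n c)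
    {t u u' : V} (ht : t ∉ range c) (hu : G.ReachableOff (range c) t u)
    (hu' : G.ReachableOff (range c) t u') {m : ℕ} (hm : m < n) (h0 : G.Adj (c 0) u)
    (h1 : G.Adj (c m) u') : m = 0 ∨ m = 1 ∨ m = n - 1 := by
  by_contra! hne
  have h3 := hc.three_le
  let T : Set V := {v | G.ReachableOff (range c) t v}
  have hT : ∀ i v, v ∈ T → c i ≠ v := fun i v hv hi ↦ hv.notMem ht ⟨i, hi⟩
  have hattach : ∀ i v, v ∈ T → G.Adj (c i) v →
      ∃ w : G.Walk (c i) t, ∀ x ∈ w.support, x = c i ∨ x ∈ T := fun i v hv hiv ↦ by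
    obtain ⟨w, hw⟩ := hv.exists_walk
    refine ⟨.cons hiv w.reverse, fun x hx ↦ ?_⟩
    rw [Walk.support_cons, List.mem_cons, Walk.support_reverse, List.mem_reverse] at hx
    exact hx.imp_right (hw x)
  have hseg : ∀ i j, i ≤ j → ∃ w : G.Walk (c i) (c j),
      ∀ x ∈ w.support, ∃ l, i ≤ l ∧ l ≤ j ∧ c l = x := fun i j hij ↦ by
    obtain ⟨k, rfl⟩ := Nat.exists_eq_add_of_le hij
    obtain ⟨w, hw, -⟩ := exists_walk_of_segment (G := G) (c := c) k i fun l _ _ ↦ hc.adj l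
    refine ⟨w, fun x hx ↦ ?_⟩
    rw [hw, List.mem_map] at hx
    obtain ⟨l, hl, rfl⟩ := hx
    rw [List.mem_range'_1] at hl
    exact ⟨l, by omega, by omega, rfl⟩
  -- the theta with ends `c 0`, `c m` and middle vertices `t`, `c 1`, `c (n - 1)`
  let SA : Fin 3 → Set V := ![{x | x = c 0 ∨ x ∈ T}, {c 0, c 1}, {c 0, c (n - 1)}]
  let SB : Fin 3 → Set V := ![{x | x = c m ∨ x ∈ T}, {x | ∃ l, 1 ≤ l ∧ l ≤ m ∧ c l = x},
    {x | ∃ l, m ≤ l ∧ l ≤ n - 1 ∧ c l = x}]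
  have hA : ∀ i, ∃ w : G.Walk (c 0) (![t, c 1, c (n - 1)] i), ∀ x ∈ w.support, x ∈ SA i := by
    intro i
    fin_cases i
    · exact hattach 0 u hu h0
    · exact ⟨(hc.adj 0).toWalk, by simp [SA]⟩
    · exact ⟨hc.adj_zero.toWalk, by simp [SA]⟩
  have hB : ∀ i, ∃ w : G.Walk (c m) (![t, c 1, c (n - 1)] i), ∀ x ∈ w.support, x ∈ SB i := by
    intro i
    fin_cases i
    · exact hattach m u' hu' h1
    · obtain ⟨w, hw⟩ := hseg 1 m (by omega)
      have hrev : ∀ x ∈ w.reverse.support, x ∈ w.support := by simp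
      exact ⟨w.reverse, fun x hx ↦ hw x (hrev x hx)⟩
    · exact hseg m (n - 1) (by omega)
  choose A hA using hA
  choose B hB using hB
  have hlt : ∀ {i j}, i < n → j < n → c i = c j → i = j := fun hi hj ↦ hc.eq_of_lt hi hj
  refine hG _ _ _ A B fun i j hij x hxA hxB ↦ ?_
  have hxA := hA i x hxA
  have hxB := hB j x hxB
  fin_cases i <;> fin_cases j
  · exact hij rfl
  · obtain ⟨l, h1, h2, rfl⟩ := hxB
    rcases hxA with h | h
    · have := hlt (by omega) (by omega) h
      omega
    · exact hT _ _ h rfl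
  · obtain ⟨l, h1, h2, rfl⟩ := hxB
    rcases hxA with h | h
    · have := hlt (by omega) (by omega) h
      omega
    · exact hT _ _ h rfl
  · rcases hxB with rfl | h
    · rcases hxA with h | h
      · have := hlt (by omega) (by omega) h
        omega
      · have := hlt (by omega) (by omega) h
        omega
    · rcases hxA with rfl | rfl <;> exact hT _ _ h rfl
  · exact hij rfl
  · obtain ⟨l, h1, h2, rfl⟩ := hxB
    rcases hxA with h | h
    · have := hlt (by omega) (by omega) h
      omega
    · have := hlt (by omega) (by omega) h
      omega
  · rcases hxB with rfl | h
    · rcases hxA with h | h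
      · have := hlt (by omega) (by omega) h
        omega
      · have := hlt (by omega) (by omega) h
        omega
    · rcases hxA with rfl | rfl <;> exact hT _ _ h rfl
  · obtain ⟨l, h1, h2, rfl⟩ := hxB
    rcases hxA with h | h
    · have := hlt (by omega) (by omega) h
      omega
    · have := hlt (by omega) (by omega) h
      omega
  · exact hij rfl

theorem NoTheta.exists_attachment (hG : G.NoTheta) {n : ℕ} {c : ℕ → V} (hc : G.IsCycleSeq n c)
    (hn : 4 ≤ n) {t : V} (ht : t ∉ range c) :
    ∃ k, ∀ i u, G.ReachableOff (range c) t u → G.Adj (c i) u → c i = c k ∨ c i = c (k + 1) := by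
  have hatt : ∀ {i u v m}, G.ReachableOff (range c) t u → G.ReachableOff (range c) t v →
      G.Adj (c i) u → G.Adj (c (i + m)) v → m < n → m = 0 ∨ m = 1 ∨ m = n - 1 :=
    fun {i u v m} hu hv h0 h1 hm ↦ by
      have hr : range (fun j ↦ c (i + j)) = range c := by
        refine Subset.antisymm (range_subset_iff.2 fun j ↦ mem_range_self _)
          (range_subset_iff.2 fun j ↦ ?_)
        obtain ⟨m, -, hm⟩ := hc.exists_lt_eq i j
        exact ⟨m, hm.symm⟩
      exact hG.eq_of_attached (hc.shift i) (hr.symm ▸ ht) (hr.symm ▸ hu) (hr.symm ▸ hv) hm h0 h1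
  by_cases hex : ∃ i u, G.ReachableOff (range c) t u ∧ G.Adj (c i) u
  · obtain ⟨i, u, hu, hiu⟩ := hex
    by_cases hex' : ∃ v, G.ReachableOff (range c) t v ∧ G.Adj (c (i + 1)) v
    · obtain ⟨v, hv, hiv⟩ := hex'
      -- an attachment at `i - 1` is not consecutive to the one at `i + 1`
      refine ⟨i, fun j w hw hjw ↦ ?_⟩
      obtain ⟨m, hm, hjm⟩ := hc.exists_lt_eq i j
      rw [hjm] at hjw ⊢
      rcases hatt hu hw hiu hjw hm with rfl | rfl | rfl
      · exact Or.inl rfl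
      · exact Or.inr rfl
      · have := hatt (m := n - 2) hv hw hiv
          (by rwa [show i + 1 + (n - 2) = i + (n - 1) by omega]) (by omega)
        omega
    · -- the index `i + (n - 1)` stands for `i - 1`
      refine ⟨i + (n - 1), fun j w hw hjw ↦ ?_⟩
      obtain ⟨m, hm, hjm⟩ := hc.exists_lt_eq i j
      rw [hjm] at hjw ⊢
      rcases hatt hu hw hiu hjw hm with rfl | rfl | rfl
      · exact Or.inr (by rw [add_assoc, Nat.sub_add_cancel (by omega), hc.apply_add, add_zero])
      · exact absurd ⟨w, hw, hjw⟩ hex'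
      · exact Or.inl rfl
  · exact ⟨0, fun i u hu hiu ↦ absurd ⟨i, u, hu, hiu⟩ hex⟩

/-! ### Four consecutive vertices of degree two -/

/-- A nonempty set `S` of non-isolated vertices that is attached to the rest of the graph only at
the ends `x`, `y` of an edge. -/
structure IsLobe (G : SimpleGraph V) (S : Set V) (x y : V) : Prop where
  nonempty : S.Nonempty
  adj : G.Adj x y
  left_notMem : x ∉ S
  right_notMem : y ∉ S
  mem_or_eq : ∀ s ∈ S, ∀ u, G.Adj s u → u ∈ S ∨ u = x ∨ u = y
  exists_adj : ∀ s ∈ S, ∃ u, G.Adj s u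

/-- The end of a path that cannot be extended inside `W` has both its neighbors on the path, which
closes a cycle. -/
theorem exists_isCycleSeq_of_end {W : Set V} {n : ℕ} {p : ℕ → V}
    (hW : ∀ i < n, p i ∈ W) (hadj : ∀ i, i + 1 < n → G.Adj (p i) (p (i + 1)))
    (hinj : ∀ i < n, ∀ j < n, p i = p j → i = j) (hn : 1 ≤ n)
    (hmax : ∀ u ∈ W, G.Adj (p (n - 1)) u → ∃ i < n, u = p i) {u v : V} (huv : u ≠ v)
    (hu : u ∈ W) (hv : v ∈ W) (hpu : G.Adj (p (n - 1)) u) (hpv : G.Adj (p (n - 1)) v) :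
    ∃ m c, G.IsCycleSeq m c ∧ ∀ i, c i ∈ W := by
  obtain ⟨i, hi, rfl⟩ := hmax u hu hpu
  obtain ⟨j, hj, rfl⟩ := hmax v hv hpv
  wlog hij : i < j generalizing i j
  · exact this j hj hv hpv i hi hu hpu huv.symm
      (lt_of_le_of_ne (not_lt.1 hij) fun h ↦ huv (by rw [h]))
  have hjn : j ≠ n - 1 := by
    rintro rfl
    exact G.irrefl hpv
  refine ⟨n - i, _, isCycleSeq_of_segment (p := fun k ↦ p (i + k)) (by omega)
    (fun k hk ↦ hadj (i + k) (by omega)) ?_ ?_, fun k ↦ hW _ ?_⟩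
  · simpa [show i + (n - i - 1) = n - 1 by omega] using hpu
  · intro k hk l hl hkl
    have := hinj _ (by omega) _ (by omega) hkl
    omega
  · have := Nat.mod_lt k (show n - i > 0 by omega)
    omega

namespace IsLobe

variable {S : Set V} {x y : V}

/-- A longest path in the lobe together with `x` and `y` closes to a cycle: at an end in `S` by the
degree condition, and otherwise by the edge `xy`. -/
theorem exists_isCycleSeq [Finite V] (h : G.IsLobe S x y)
    (hdeg : ∀ v u, G.neighborSet v ≠ {u}) :
    ∃ n c, G.IsCycleSeq n c ∧ ∀ i, c i ∈ S ∪ {x, y} := by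
  have hdeg' : ∀ s ∈ S, ∃ u v, u ≠ v ∧ u ∈ S ∪ {x, y} ∧ v ∈ S ∪ {x, y} ∧ G.Adj s u ∧
      G.Adj s v := fun s hs ↦ by
    obtain ⟨u, hu⟩ := h.exists_adj s hs
    have : ∃ v, G.Adj s v ∧ v ≠ u := by
      by_contra! hcon
      exact hdeg s u (Subset.antisymm (fun v hv ↦ hcon v hv) (by simpa using hu))
    obtain ⟨v, hv, hvu⟩ := this
    exact ⟨u, v, hvu.symm, h.mem_or_eq s hs u hu, h.mem_or_eq s hs v hv, hu, hv⟩
  let P : ℕ → Prop := fun n ↦ ∃ p : ℕ → V, (∀ i < n, p i ∈ S ∪ {x, y}) ∧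
    (∀ i, i + 1 < n → G.Adj (p i) (p (i + 1))) ∧ ∀ i < n, ∀ j < n, p i = p j → i = j
  have hbdd : ∀ n, P n → n ≤ Nat.card V := by
    rintro n ⟨p, -, -, hp⟩
    simpa using Nat.card_le_card_of_injective (fun i : Fin n ↦ p i)
      fun i j hij ↦ Fin.ext (hp i i.2 j j.2 hij)
  -- a vertex of the lobe with two of its neighbors
  have h3 : P 3 := by
    obtain ⟨s, hs⟩ := h.nonempty
    obtain ⟨u, v, huv, hu, hv, hsu, hsv⟩ := hdeg' s hs
    refine ⟨fun i ↦ if i = 0 then u else if i = 1 then s else v, fun i hi ↦ ?_, fun i hi ↦ ?_,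
      fun i hi j hj hij ↦ ?_⟩
    · have hs' : s ∈ S ∪ {x, y} := Or.inl hs
      dsimp only
      split_ifs <;> assumption
    · have : i < 2 := by omega
      interval_cases i
      · simpa using hsu.symm
      · simpa using hsv
    · have := hsu.ne
      have := hsv.ne
      interval_cases i <;> interval_cases j <;> simp_all
  classical
  obtain ⟨n, hn, hmax⟩ : ∃ n, P n ∧ ∀ m, P m → m ≤ n :=
    ⟨Nat.findGreatest P (Nat.card V), Nat.findGreatest_spec (hbdd 3 h3) h3,
      fun m hm ↦ Nat.le_findGreatest (hbdd m hm) hm⟩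
  have hn3 : 3 ≤ n := hmax 3 h3
  have hext : ∀ p : ℕ → V, (∀ i < n, p i ∈ S ∪ {x, y}) →
      (∀ i, i + 1 < n → G.Adj (p i) (p (i + 1))) → (∀ i < n, ∀ j < n, p i = p j → i = j) →
      p (n - 1) ∈ S → ∃ n c, G.IsCycleSeq n c ∧ ∀ i, c i ∈ S ∪ {x, y} := by
    intro p hW hadj hinj hend
    obtain ⟨u, v, huv, hu, hv, hsu, hsv⟩ := hdeg' _ hend
    refine exists_isCycleSeq_of_end hW hadj hinj (by omega) (fun w hw hpw ↦ ?_) huv hu hv hsu hsv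
    by_contra! hcon
    have : P (n + 1) := by
      refine ⟨fun i ↦ if i < n then p i else w, fun i hi ↦ ?_, fun i hi ↦ ?_,
        fun i hi j hj hij ↦ ?_⟩
      · dsimp only
        split_ifs with h
        · exact hW i h
        · exact hw
      · have h1 : i < n := by omega
        by_cases h2 : i + 1 < n
        · simpa [h1, h2] using hadj i h2
        · obtain rfl : i = n - 1 := by omega
          simpa [h1, h2] using hpw
      · dsimp only at hij
        split_ifs at hij with h1 h2 h2
        · exact hinj i h1 j h2 hij
        · exact absurd hij.symm (hcon i h1)
        · exact absurd hij (hcon j h2)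
        · omega
    have := hmax _ this
    omega
  obtain ⟨p, hW, hadj, hinj⟩ := hn
  by_cases hlast : p (n - 1) ∈ S
  · exact hext p hW hadj hinj hlast
  by_cases hfirst : p 0 ∈ S
  · refine hext (fun i ↦ p (n - 1 - i)) (fun i hi ↦ hW _ (by omega)) (fun i hi ↦ ?_)
      (fun i hi j hj hij ↦ ?_) (by simpa using hfirst)
    · have := hadj (n - 1 - (i + 1)) (by omega)
      rw [show n - 1 - (i + 1) + 1 = n - 1 - i by omega] at this
      exact this.symm
    · have := hinj _ (by omega) _ (by omega) hij
      omega
  · have hclose : G.Adj (p (n - 1)) (p 0) := by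
      have hne : p (n - 1) ≠ p 0 := fun heq ↦ by
        have := hinj _ (by omega) _ (by omega) heq
        omega
      have hxy := h.adj
      have h1 := (hW (n - 1) (by omega)).resolve_left hlast
      have h2 := (hW 0 (by omega)).resolve_left hfirst
      rcases h1 with h1 | h1 <;> rcases h2 with h2 | h2 <;> rw [h1, h2] at hne ⊢
      · exact absurd rfl hne
      · exact hxy
      · exact hxy.symm
      · exact absurd rfl hne
    exact ⟨n, _, isCycleSeq_of_segment hn3 hadj hclose hinj,
      fun i ↦ hW _ (Nat.mod_lt _ (by omega))⟩

/-- In a lobe that contains no smaller lobe, every component that is attached to a cycle at a vertex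
of the lobe contains an end of the lobe: otherwise it would be a smaller lobe. -/
theorem reachableOff_end (h : G.IsLobe S x y) (hG : G.NoTheta)
    (hmin : ∀ T x' y', G.IsLobe T x' y' → ¬ T ⊂ S) {n : ℕ} {c : ℕ → V} (hc : G.IsCycleSeq n c)
    (hn : 4 ≤ n) {i : ℕ} (hi : c i ∈ S) {u : V} (hu : u ∉ range c) (hiu : G.Adj (c i) u) :
    G.ReachableOff (range c) u x ∨ G.ReachableOff (range c) u y := by
  by_contra! hcon
  obtain ⟨hx, hy⟩ := hcon
  have hTS : ∀ v, G.ReachableOff (range c) u v → v ∈ S := by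
    have key : ∀ b v, G.ReachableOff (range c) u v → b ∈ S → G.Adj b v → v ∈ S :=
      fun b v hv hb hbv ↦ by
        rcases h.mem_or_eq b hb v hbv with h | rfl | rfl
        · exact h
        · exact absurd hv hx
        · exact absurd hv hy
    intro v hv
    induction hv with
    | refl => exact key _ _ .refl hi hiu
    | @tail b d hb hbd ih => exact key b d (hb.tail hbd) ih hbd.1
  obtain ⟨k, hk⟩ := hG.exists_attachment hc hn hu
  refine hmin {v | G.ReachableOff (range c) u v} (c k) (c (k + 1))
    ⟨⟨u, .refl⟩, hc.adj k, fun hm ↦ hm.notMem hu ⟨k, rfl⟩, fun hm ↦ hm.notMem hu ⟨_, rfl⟩,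
      fun s hs v hsv ↦ ?_, fun s hs ↦ h.exists_adj s (hTS s hs)⟩
    ⟨hTS, fun hsub ↦ (hsub hi).notMem hu ⟨i, rfl⟩⟩
  by_cases hv : v ∈ range c
  · obtain ⟨j, rfl⟩ := hv
    exact Or.inr (hk j s hs hsv.symm)
  · exact Or.inl (hs.tail ⟨hsv, hv⟩)

/-- On a shortest cycle of a minimal lobe, only two consecutive vertices have neighbors outside
the cycle. -/
theorem exists_forall_adj_mem_range (h : G.IsLobe S x y) (hG : G.NoTheta)
    (hmin : ∀ T x' y', G.IsLobe T x' y' → ¬ T ⊂ S) {n : ℕ} {c : ℕ → V} (hc : G.IsCycleSeq n c)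
    (hn : 4 ≤ n) (hW : ∀ i, c i ∈ S ∪ {x, y})
    (hcmin : ∀ m c', G.IsCycleSeq m c' → (∀ i, c' i ∈ S ∪ {x, y}) → n ≤ m) :
    ∃ k, ∀ i, c i ≠ c k → c i ≠ c (k + 1) → ∀ u, G.Adj (c i) u → u ∈ range c := by
  by_cases hxy : x ∈ range c ∧ y ∈ range c
  · obtain ⟨⟨a, rfl⟩, ⟨b, rfl⟩⟩ := hxy
    -- both ends lie on the cycle, and are consecutive since there are no chords
    obtain ⟨k, hk⟩ : ∃ k, ∀ i, c i ≠ c k → c i ≠ c (k + 1) → c i ≠ c a ∧ c i ≠ c b := by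
      obtain ⟨m, hm, hbm⟩ := hc.exists_lt_eq a b
      have hadj := h.adj
      rw [hbm] at hadj
      rcases (hc.shift a).eq_of_adj_zero (fun i ↦ hW _) hcmin hm hadj with rfl | rfl
      · exact ⟨a, fun i h1 h2 ↦ ⟨h1, hbm ▸ h2⟩⟩
      · refine ⟨a + (n - 1), fun i h1 h2 ↦ ⟨?_, hbm ▸ h1⟩⟩
        rwa [add_assoc, Nat.sub_add_cancel (by omega), hc.apply_add] at h2
    refine ⟨k, fun i h1 h2 u hiu ↦ ?_⟩
    by_contra hu
    obtain ⟨ha, hb⟩ := hk i h1 h2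
    have hi : c i ∈ S := (hW i).resolve_right (by simp [ha, hb])
    rcases h.reachableOff_end hG hmin hc hn hi hu hiu with hr | hr <;>
      exact hr.notMem hu (mem_range_self _)
  · -- otherwise some end `q` lies outside, and only its component is attached to the cycle
    have main : ∀ q q', G.Adj q q' → (∀ i, c i ∈ S ∪ {q, q'}) → (∀ i, c i ∈ S →
        ∀ u, u ∉ range c → G.Adj (c i) u →
          G.ReachableOff (range c) u q ∨ G.ReachableOff (range c) u q') → q ∉ range c →
        ∃ k, ∀ i, c i ≠ c k → c i ≠ c (k + 1) → ∀ u, G.Adj (c i) u → u ∈ range c := by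
      intro q q' hqq hW hend hq
      obtain ⟨k, hk⟩ := hG.exists_attachment hc hn hq
      refine ⟨k, fun i h1 h2 u hiu ↦ ?_⟩
      by_contra hu
      have hatt : ∀ v, G.ReachableOff (range c) q v → ¬ G.Adj (c i) v := fun v hv hiv ↦
        (hk i v hv hiv).elim h1 h2
      have hi : c i ∈ S := by
        refine (hW i).resolve_right ?_
        rintro (hiq | hiq)
        · exact hq ⟨i, hiq⟩
        · rw [mem_singleton_iff] at hiq
          exact hatt q .refl (hiq ▸ hqq.symm)
      rcases hend i hi u hu hiu with hr | hr
      · exact hatt u (hr.symm hu) hiu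
      · exact hatt u (.head ⟨hqq, hr.notMem hu⟩ (hr.symm hu)) hiu
    by_cases hx : x ∈ range c
    · exact main y x h.adj.symm (by rwa [pair_comm])
        (fun i hi u hu hiu ↦ (h.reachableOff_end hG hmin hc hn hi hu hiu).symm)
        fun hy ↦ hxy ⟨hx, hy⟩
    · exact main x y h.adj hW (fun i hi u hu hiu ↦ h.reachableOff_end hG hmin hc hn hi hu hiu) hx

end IsLobe

/-- The vertices `d 1`, …, `d 4` have degree two and are consecutive on a path `d 0`, …, `d 5`. They
lie on a shortest cycle of a minimal lobe. -/
theorem NoTheta.exists_thread [Finite V] (hG : G.NoTheta) (hgirth : 6 ≤ G.egirth)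
    (hdeg : ∀ v u, G.neighborSet v ≠ {u}) (hne : ∃ x y, G.Adj x y) :
    ∃ d : ℕ → V, (∀ i < 6, ∀ j < 6, d i = d j → i = j) ∧
      ∀ i < 4, G.neighborSet (d (i + 1)) = {d i, d (i + 2)} := by
  have hex : {S : Set V | ∃ x y, G.IsLobe S x y}.Nonempty := by
    obtain ⟨x, y, hxy⟩ := hne
    refine ⟨{v | (∃ u, G.Adj v u) ∧ v ≠ x ∧ v ≠ y}, x, y, ?_, hxy, by simp, by simp,
      fun s hs u hsu ↦ ?_, fun s hs ↦ hs.1⟩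
    · by_contra hcon
      refine hdeg x y (Subset.antisymm (fun v hv ↦ ?_) (by simpa using hxy))
      by_contra hvy
      exact hcon ⟨v, ⟨x, hv.symm⟩, hv.ne', hvy⟩
    · by_cases hux : u = x
      · exact Or.inr (Or.inl hux)
      · by_cases huy : u = y
        · exact Or.inr (Or.inr huy)
        · exact Or.inl ⟨⟨s, hsu.symm⟩, hux, huy⟩
  obtain ⟨S, ⟨x, y, hS⟩, hSmin⟩ := wellFounded_lt.has_min _ hex
  have hmin : ∀ T x' y', G.IsLobe T x' y' → ¬ T ⊂ S := fun T x' y' hT ↦ hSmin T ⟨x', y', hT⟩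
  classical
  have hcyc := hS.exists_isCycleSeq hdeg
  obtain ⟨c, hc, hW⟩ := Nat.find_spec hcyc
  have hcmin : ∀ m c', G.IsCycleSeq m c' → (∀ i, c' i ∈ S ∪ {x, y}) → Nat.find hcyc ≤ m :=
    fun m c' h h' ↦ Nat.find_min' hcyc ⟨c', h, h'⟩
  generalize Nat.find hcyc = n at hc hcmin
  have hn : 6 ≤ n := by exact_mod_cast hgirth.trans hc.egirth_le
  obtain ⟨k, hk⟩ := hS.exists_forall_adj_mem_range hG hmin hc (by omega) hW hcmin
  have hinj : ∀ i < n, ∀ j < n, c (k + i) = c (k + j) → i = j := fun i hi j hj hij ↦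
    (hc.shift k).eq_of_lt hi hj hij
  refine ⟨fun i ↦ c (k + 1 + i), fun i hi j hj hij ↦ (hc.shift (k + 1)).eq_of_lt (by omega)
    (by omega) hij, fun i hi ↦ Subset.antisymm (fun u hu ↦ ?_) ?_⟩
  · obtain ⟨l, rfl⟩ : u ∈ range c := by
      refine hk (k + 1 + (i + 1)) (fun heq ↦ ?_) (fun heq ↦ ?_) u hu
      · have := hinj (1 + (i + 1)) (by omega) 0 (by omega) (by rwa [← add_assoc])
        omega
      · have := hinj (1 + (i + 1)) (by omega) 1 (by omega) (by rwa [← add_assoc])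
        omega
    obtain ⟨m, hm, hlm⟩ := hc.exists_lt_eq (k + 1 + (i + 1)) l
    rw [mem_neighborSet, hlm] at hu
    rw [hlm]
    rcases (hc.shift (k + 1 + (i + 1))).eq_of_adj_zero (fun i ↦ hW _) hcmin hm hu with rfl | rfl
    · exact Or.inr rfl
    · refine Or.inl ?_
      rw [show k + 1 + (i + 1) + (n - 1) = k + 1 + i + n by omega, hc.apply_add]
  · rintro _ (rfl | rfl)
    · exact (hc.adj (k + 1 + i)).symm
    · exact hc.adj (k + 1 + (i + 1))

/-! ### Extending colorings -/

/-- The graph `G` with all edges that meet `X` removed. -/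
def isolate (G : SimpleGraph V) (X : Set V) : SimpleGraph V where
  Adj u v := G.Adj u v ∧ u ∉ X ∧ v ∉ X
  symm := ⟨fun _ _ h ↦ ⟨h.1.symm, h.2.2, h.2.1⟩⟩
  loopless := ⟨fun _ h ↦ G.irrefl h.1⟩

theorem isolate_lt {X : Set V} {u v : V} (hv : v ∈ X) (h : G.Adj v u) : G.isolate X < G :=
  lt_of_le_of_ne (fun _ _ h ↦ h.1) fun heq ↦ by
    rw [← heq] at h
    exact h.2.1 hv

/-- A conflict-free coloring `c` of `G` without the edges at `X` can be changed on `X` to one of `G`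
if no vertex outside has two neighbors in `X` and the new colors avoid, besides the obvious
conflicts, a color `a u` that occurs exactly once around `u` so far. -/
theorem PCFColorable.of_isolate {X : Set V} {k : ℕ} (h : (G.isolate X).PCFColorable k)
    (hX : ∀ u ∉ X, (G.neighborSet u ∩ X).Subsingleton)
    (hext : ∀ c a : V → Fin k, ∃ c' : V → Fin k, (∀ u ∉ X, c' u = c u) ∧
      (∀ x ∈ X, ∀ u, G.Adj x u → c' x ≠ c' u) ∧ (∀ x ∈ X, ∀ u ∉ X, G.Adj x u → c' x ≠ a u) ∧
      ∀ x ∈ X, ∃ b, ∃! w, w ∈ G.neighborSet x ∧ c' w = b) : G.PCFColorable k := by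
  obtain ⟨c, hc⟩ := h
  have hex : ∀ u, ∃ b, ((G.isolate X).neighborSet u).Nonempty →
      ∃! w, w ∈ (G.isolate X).neighborSet u ∧ c w = b := fun u ↦ by
    by_cases hu : ((G.isolate X).neighborSet u).Nonempty
    · exact (hc u hu).imp fun b hb _ ↦ hb
    · exact ⟨c u, fun h ↦ absurd h hu⟩
  choose a ha using hex
  obtain ⟨c', hoff, hproper, havoid, hconf⟩ := hext c a
  refine ⟨Coloring.mk c' fun {u v} huv ↦ ?_, fun u hu ↦ ?_⟩
  · by_cases hu : u ∈ X
    · exact hproper u hu v huv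
    by_cases hv : v ∈ X
    · exact (hproper v hv u huv.symm).symm
    rw [hoff u hu, hoff v hv]
    exact c.valid ⟨huv, hu, hv⟩
  · change ∃ b, ∃! w, w ∈ G.neighborSet u ∧ c' w = b
    by_cases huX : u ∈ X
    · exact hconf u huX
    by_cases hN : ((G.isolate X).neighborSet u).Nonempty
    · obtain ⟨w, ⟨hw, hwa⟩, huniq⟩ := ha u hN
      refine ⟨a u, w, ⟨hw.1, (hoff w hw.2.2).trans hwa⟩, fun v hv ↦ ?_⟩
      have hvX : v ∉ X := fun hvX ↦ havoid v hvX u huX (Adj.symm hv.1) hv.2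
      exact huniq v ⟨⟨hv.1, huX, hvX⟩, (hoff v hvX).symm.trans hv.2⟩
    · obtain ⟨w, hw⟩ := hu
      have hmem : ∀ v ∈ G.neighborSet u, v ∈ X := fun v hv ↦ by
        by_contra hvX
        exact hN ⟨v, hv, huX, hvX⟩
      exact ⟨c' w, w, ⟨hw, rfl⟩, fun v hv ↦ hX u huX ⟨hv.1, hmem v hv.1⟩ ⟨hw, hmem w hw⟩⟩

theorem PCFColorable.of_isolate_leaf {v u : V} (hv : G.neighborSet v = {u})
    (h : (G.isolate {v}).PCFColorable 4) : G.PCFColorable 4 := by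
  classical
  refine h.of_isolate (fun _ _ ↦ subsingleton_singleton.anti inter_subset_right) fun c a ↦ ?_
  have hN : ∀ w, G.Adj v w ↔ w = u := fun w ↦ by
    rw [← mem_neighborSet, hv, mem_singleton_iff]
  have huv : u ≠ v := fun h ↦ G.irrefl (h ▸ (hN u).2 rfl)
  obtain ⟨e, he, hea⟩ : ∃ e, e ≠ c u ∧ e ≠ a u := by
    generalize c u = p, a u = q
    revert p q
    decide
  refine ⟨Function.update c v e, fun w hw ↦ Function.update_of_ne hw _ _, ?_, ?_, ?_⟩
  · rintro _ rfl w hw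
    obtain rfl := (hN w).1 hw
    simpa [huv] using he
  · rintro _ rfl w - hw
    obtain rfl := (hN w).1 hw
    simpa using hea
  · rintro _ rfl
    refine ⟨c u, u, ⟨(hN u).2 rfl, by simp [huv]⟩, fun w hw ↦ (hN w).1 hw.1⟩

set_option synthInstance.maxSize 1000 in
/-- Four colors suffice along a thread: with prescribed end colors `p`, `q`, and one further color
forbidden next to each end, any two positions at distance at most two can be made different. -/
theorem exists_thread_coloring (p q α β : Fin 4) :
    ∃ F : ℕ → Fin 4, F 0 = p ∧ F 5 = q ∧ F 1 ≠ α ∧ F 4 ≠ β ∧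
      (∀ i < 5, F i ≠ F (i + 1)) ∧ ∀ i < 4, F i ≠ F (i + 2) := by
  obtain ⟨r, hr, s, hs, t, ht, u, hu⟩ : ∃ r, (r ≠ p ∧ r ≠ α) ∧ ∃ s, (s ≠ p ∧ s ≠ r) ∧
      ∃ t, (t ≠ q ∧ t ≠ r ∧ t ≠ s) ∧ ∃ u, u ≠ q ∧ u ≠ β ∧ u ≠ s ∧ u ≠ t := by
    revert p q α β
    decide
  refine ⟨fun i ↦ [p, r, s, t, u, q].getD i 0, rfl, rfl, hr.2, hu.2.1, fun i hi ↦ ?_,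
    fun i hi ↦ ?_⟩
  · interval_cases i
    exacts [hr.1.symm, hs.2.symm, ht.2.2.symm, hu.2.2.2.symm, hu.1]
  · interval_cases i
    exacts [hs.1.symm, ht.2.1.symm, hu.2.2.1.symm, ht.1]

theorem PCFColorable.of_isolate_thread {d : ℕ → V} (hd : ∀ i < 6, ∀ j < 6, d i = d j → i = j)
    (hN : ∀ i < 4, G.neighborSet (d (i + 1)) = {d i, d (i + 2)})
    (h : (G.isolate {v | ∃ i < 4, v = d (i + 1)}).PCFColorable 4) : G.PCFColorable 4 := by
  have hadj : ∀ i < 4, ∀ u, G.Adj (d (i + 1)) u → u = d i ∨ u = d (i + 2) := fun i hi u hu ↦ by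
    rwa [← mem_neighborSet, hN i hi] at hu
  have hends : ∀ i < 4, ∀ u, u ∉ {v | ∃ i < 4, v = d (i + 1)} → G.Adj (d (i + 1)) u →
      i = 0 ∧ u = d 0 ∨ i = 3 ∧ u = d 5 := by
    intro i hi u hu hiu
    rcases hadj i hi u hiu with rfl | rfl
    · rcases i with _ | i
      · exact Or.inl ⟨rfl, rfl⟩
      · exact absurd ⟨i, by omega, rfl⟩ hu
    · rcases Nat.lt_or_ge i 3 with h | h
      · exact absurd ⟨i + 1, by omega, rfl⟩ hu
      · obtain rfl : i = 3 := by omega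
        exact Or.inr ⟨rfl, rfl⟩
  refine h.of_isolate ?_ fun c a ↦ ?_
  · rintro u hu _ ⟨hx, i, hi, rfl⟩ _ ⟨hy, j, hj, rfl⟩
    have h05 : d 0 ≠ d 5 := fun h ↦ by
      have := hd 0 (by omega) 5 (by omega) h
      omega
    rcases hends i hi u hu (Adj.symm hx) with ⟨rfl, h1⟩ | ⟨rfl, h1⟩ <;>
      rcases hends j hj u hu (Adj.symm hy) with ⟨rfl, h2⟩ | ⟨rfl, h2⟩
    · rfl
    · exact absurd (h1.symm.trans h2) h05
    · exact absurd (h2.symm.trans h1) h05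
    · rfl
  · obtain ⟨F, hF0, hF5, hFα, hFβ, hF1, hF2⟩ :=
      exists_thread_coloring (c (d 0)) (c (d 5)) (a (d 0)) (a (d 5))
    have hinj : Function.Injective fun i : Fin 6 ↦ d i := fun i j hij ↦
      Fin.ext (hd i i.2 j j.2 hij)
    obtain ⟨c', hc', hoff⟩ : ∃ c' : V → Fin 4, (∀ i < 6, c' (d i) = F i) ∧
        ∀ u, u ∉ {v | ∃ i < 4, v = d (i + 1)} → c' u = c u := by
      have hcd : ∀ i < 6, Function.extend (fun i : Fin 6 ↦ d i) (fun i ↦ F i) c (d i) = F i :=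
        fun i hi ↦ hinj.extend_apply _ _ ⟨i, hi⟩
      refine ⟨_, hcd, fun u hu ↦ ?_⟩
      by_cases hex : ∃ i : Fin 6, d i = u
      · obtain ⟨⟨i, hi⟩, rfl⟩ := hex
        rw [hcd i hi]
        rcases i with _ | i
        · exact hF0
        · by_cases hi4 : i < 4
          · exact absurd ⟨i, hi4, rfl⟩ hu
          · obtain rfl : i = 4 := by omega
            exact hF5
      · exact Function.extend_apply' _ _ _ hex
    refine ⟨c', hoff, ?_, ?_, ?_⟩
    · rintro _ ⟨i, hi, rfl⟩ u hu
      rcases hadj i hi u hu with rfl | rfl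
      · rw [hc' _ (by omega), hc' _ (by omega)]
        exact (hF1 i (by omega)).symm
      · rw [hc' _ (by omega), hc' _ (by omega)]
        exact hF1 (i + 1) (by omega)
    · rintro _ ⟨i, hi, rfl⟩ u hu hiu
      rw [hc' _ (by omega)]
      rcases hends i hi u hu hiu with ⟨rfl, rfl⟩ | ⟨rfl, rfl⟩
      · exact hFα
      · exact hFβ
    · rintro _ ⟨i, hi, rfl⟩
      refine ⟨F i, d i, ⟨?_, hc' i (by omega)⟩, fun w hw ↦ ?_⟩
      · rw [hN i hi]
        exact Or.inl rfl
      · refine (hadj i hi w hw.1).resolve_right ?_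
        rintro rfl
        exact hF2 i hi ((hw.2.symm.trans (hc' _ (by omega))))

theorem NoTheta.pcfColorable [Finite V] (hG : G.NoTheta) (hgirth : 6 ≤ G.egirth) :
    G.PCFColorable 4 := by
  induction G using WellFoundedLT.induction with
  | ind G ih =>
    by_cases hne : ∃ x y, G.Adj x y
    · by_cases hdeg : ∃ v u, G.neighborSet v = {u}
      · obtain ⟨v, u, hv⟩ := hdeg
        have hlt : G.isolate {v} < G :=
          isolate_lt rfl (show u ∈ G.neighborSet v by rw [hv]; rfl)
        exact .of_isolate_leaf hv (ih _ hlt (hG.mono hlt.le) (hgirth.trans (egirth_anti hlt.le)))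
      · obtain ⟨d, hd, hN⟩ := hG.exists_thread hgirth (by simpa using hdeg) hne
        have hlt : G.isolate {v | ∃ i < 4, v = d (i + 1)} < G :=
          isolate_lt ⟨0, by omega, rfl⟩
            (show d 0 ∈ G.neighborSet (d (0 + 1)) by rw [hN 0 (by omega)]; exact Or.inl rfl)
        exact .of_isolate_thread hd hN
          (ih _ hlt (hG.mono hlt.le) (hgirth.trans (egirth_anti hlt.le)))
    · push Not at hne
      exact ⟨Coloring.mk (fun _ ↦ 0) fun {u v} h ↦ absurd h (hne u v),
        fun v ⟨u, hu⟩ ↦ absurd hu (hne v u)⟩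

end SimpleGraph

theorem mainTheorem7 {V : Type*} [Finite V] (G : SimpleGraph V) (hG : G.IsOuterplanar)
    (hgirth : 6 ≤ G.egirth) : G.PCFColorable 4 :=
  hG.noTheta.pcfColorable hgirth
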